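/- For an automorphism $\varphi$ of a group $\Gamma$, let the Reidemeister number $R(\varphi)\in\{1,2,\dots\}\cup\{\infty\}$ be the number of classes of the equivalence relation $x\sim g\,x\,\varphi(g^{-1})$, $g\in\Gamma$; the group $\Gamma$ has property $R_\infty$ if $R(\varphi)=\infty$ for every automorphism $\varphi$ of $\Gamma$. For an abelian group $G$ and an integer $k\ge 0$ let $G\wr\mathbb{Z}^k=\Sigma\rtimes_\alpha\mathbb{Z}^k$ be the restricted wreath product, where $\Sigma=\bigoplus_{x\in\mathbb{Z}^k}G_x$ is a direct sum of copies $G_x$ of $G$ and $\alpha(x)(g_y)=g_{x+y}$, with $g_y$ denoting $g\in G\cong G_y$. **Theorem.** Let $G$ be a finite abelian group with prime-power decomposition $G\cong\bigoplus_{i}(\mathbb{Z}_{p_i^{r_i}})^{d_i}$, where $i$ runs over a finite index set, the $p_i$ are primes (not necessarily distinct), $r_i\ge 1$, $d_i\ge 1$, and the pairs $(p_i,r_i)$ are pairwise distinct. Suppose that at least one of the following conditions holds: 1. $d_i\ge 2$ for every $i$ with $p_i\in\{2,3\}$ (and $k$ is arbitrary); 2. $p_i\ne 2$ for all $i$, and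 $k$ is even; 3. $d_i\ge 2$ for every $i$ with $p_i=2$, and $4\mid k$; 4. $d_i\ge 3$ for every $i$ with $p_i=2$, and $k$ is even; 5. $d_i\ge 2$ and $d_i\ne 3$ for every $i$ with $p_i=2$, and $k$ is even with $k\ge 4$. Then $G\wr\mathbb{Z}^k$ admits an automorphism $\varphi$ with $R(\varphi)<\infty$; that is, $G\wr\mathbb{Z}^k$ does not have property $R_\infty$. -/

import Mathlib

/-- Twisted conjugacy with respect to an automorphism `φ` of a group:
`x ∼ g * x * φ (g⁻¹)`. -/
def reidemeisterSetoid {Γ : Type*} [Group Γ] (φ : Γ ≃* Γ) : Setoid Γ where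
  r x y := ∃ g : Γ, y = g * x * φ g⁻¹
  iseqv :=
    { refl := fun x => ⟨1, by simp⟩
      symm := by
        rintro x y ⟨g, rfl⟩
        exact ⟨g⁻¹, by simp [mul_assoc]⟩
      trans := by
        rintro x y z ⟨g, rfl⟩ ⟨h, rfl⟩
        exact ⟨h * g, by simp [mul_assoc]⟩ }

/-- The Reidemeister number of `φ`: the number of its twisted conjugacy classes,
with value `⊤` if there are infinitely many. -/
noncomputable def reidemeisterNumber {Γ : Type*} [Group Γ] (φ : Γ ≃* Γ) : ℕ∞ :=
  ENat.card (Quotient (reidemeisterSetoid φ))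

/-- The property `R_∞`: every automorphism has infinite Reidemeister number. -/
def HasRInfinity (Γ : Type*) [Group Γ] : Prop :=
  ∀ φ : Γ ≃* Γ, reidemeisterNumber φ = ⊤

/-- The action of `ℤ^k` on the direct sum `Σ` of copies `G_x` of `G`, `x ∈ ℤ^k` (finitely
supported functions `ℤ^k → G`), by translation of the index: `α(x)(g_y) = g_{x+y}`.
Both groups are written multiplicatively. -/
noncomputable def wreathAction (G : Type*) [AddCommGroup G] (k : ℕ) :
    Multiplicative (Fin k → ℤ) →* MulAut (Multiplicative ((Fin k → ℤ) →₀ G)) where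
  toFun x := AddEquiv.toMultiplicative (Finsupp.domCongr (Equiv.addLeft x.toAdd))
  map_one' := by
    refine MulEquiv.ext fun f => Multiplicative.toAdd.injective (Finsupp.ext fun y => ?_)
    simp
    rfl
  map_mul' x x' := by
    refine MulEquiv.ext fun f => Multiplicative.toAdd.injective (Finsupp.ext fun y => ?_)
    change Multiplicative.toAdd f (-(x.toAdd + x'.toAdd) + y) =
      Multiplicative.toAdd f (-x'.toAdd + (-x.toAdd + y))
    rw [neg_add_rev, add_assoc]

/-- The defining formula `α(x)(g_y) = g_{x+y}`. -/
theorem wreathAction_single (G : Type*) [AddCommGroup G] (k : ℕ) (x y : Fin k → ℤ) (g : G) :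
    wreathAction G k (Multiplicative.ofAdd x) (Multiplicative.ofAdd (Finsupp.single y g)) =
      Multiplicative.ofAdd (Finsupp.single (x + y) g) := by
  simp [wreathAction]

/-- The restricted wreath product `G ≀ ℤ^k = Σ ⋊ ℤ^k`. -/
abbrev RestrictedWreath (G : Type*) [AddCommGroup G] (k : ℕ) : Type _ :=
  Multiplicative ((Fin k → ℤ) →₀ G) ⋊[wreathAction G k] Multiplicative (Fin k → ℤ)

open Polynomial

/-! Let `A` act on ℤ^k with 1 + A + ⋯ + A^(m-1) = 0, and `F` on `G` with F^m - 1 surjective;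
together they induce an automorphism of the wreath product. Modulo the geometric sum, A - 1 divides
m, so twisted conjugation brings the ℤ^k-component into the finite box [0, m)^k. Over a fixed z in
the box, twisted conjugation by t ∈ Σ changes the Σ-component by t - T t, where T is `shiftedAut A F
z`. The affine map y ↦ z + A y has m-th iterate the identity, so T^m is F^m applied coordinatewise;
as T - 1 divides T^m - 1, it is surjective and the Σ-component can be killed. At most m^k classes
remain.

It remains to match an m for ℤ^k with one for `G`: m = 2, 3, 5 or 35. On ℤ^k, `A` is built from
companion matrices of Φ_2, Φ_3, Φ_5, Φ_7; on each (ℤ/p^r)^d, `F` is a scalar or is built from roots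
of trinomials X^d - X^i - 1. -/

/-- `M` has an automorphism annihilated by `1 + X + ⋯ + X ^ (m - 1)`. -/
def HasGeomSumZeroAut (m : ℕ) (M : Type*) [AddCommGroup M] : Prop :=
  ∃ A : M ≃+ M, ∀ x, ∑ j ∈ Finset.range m, A^[j] x = 0

/-- `M` has an automorphism `F` such that `F ^ m - 1` is surjective. -/
def HasPowSubOneSurjectiveAut (m : ℕ) (M : Type*) [AddCommGroup M] : Prop :=
  ∃ F : M ≃+ M, Function.Surjective fun x => F^[m] x - x

/-! ### Finiteness of the Reidemeister number from a pair `A`, `F`. -/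

section Wreath

variable {G : Type*} [AddCommGroup G] {k : ℕ}

/-- The automorphism `g_x ↦ F(g)_{A x}` of the direct sum. -/
noncomputable def baseAut (A : (Fin k → ℤ) ≃+ (Fin k → ℤ)) (F : G ≃+ G) :
    ((Fin k → ℤ) →₀ G) ≃+ ((Fin k → ℤ) →₀ G) :=
  (Finsupp.domCongr A.toEquiv).trans (Finsupp.mapRange.addEquiv F)

theorem baseAut_apply (A : (Fin k → ℤ) ≃+ (Fin k → ℤ)) (F : G ≃+ G) (f : (Fin k → ℤ) →₀ G)
    (y : Fin k → ℤ) : baseAut A F f y = F (f (A.symm y)) := by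
  simp [baseAut]

theorem wreathAction_apply (z y : Fin k → ℤ) (f : (Fin k → ℤ) →₀ G) :
    (wreathAction G k (.ofAdd z) (.ofAdd f)).toAdd y = f (-z + y) := by
  simp [wreathAction]

/-- The automorphism of the wreath product induced by `A` and `F`. -/
noncomputable def wreathAut (A : (Fin k → ℤ) ≃+ (Fin k → ℤ)) (F : G ≃+ G) :
    RestrictedWreath G k ≃* RestrictedWreath G k :=
  SemidirectProduct.congr (AddEquiv.toMultiplicative (baseAut A F)) (AddEquiv.toMultiplicative A)
    (by
      intro z
      ext f : 1
      apply Multiplicative.toAdd.injective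
      ext y
      change baseAut A F (wreathAction G k (.ofAdd z.toAdd) (.ofAdd f.toAdd)).toAdd y =
        (wreathAction G k (.ofAdd (A z.toAdd)) (.ofAdd (baseAut A F f.toAdd))).toAdd y
      rw [baseAut_apply, wreathAction_apply, wreathAction_apply, baseAut_apply]
      simp)

/-- The action on the direct sum of `z` composed with `baseAut A F`. -/
noncomputable def shiftedAut (A : (Fin k → ℤ) ≃+ (Fin k → ℤ)) (F : G ≃+ G) (z : Fin k → ℤ) :
    ((Fin k → ℤ) →₀ G) ≃+ ((Fin k → ℤ) →₀ G) :=
  (baseAut A F).trans (Finsupp.domCongr (Equiv.addLeft z))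

theorem shiftedAut_apply (A : (Fin k → ℤ) ≃+ (Fin k → ℤ)) (F : G ≃+ G) (z y : Fin k → ℤ)
    (f : (Fin k → ℤ) →₀ G) : shiftedAut A F z f y = F (f (A.symm (-z + y))) := by
  simp [shiftedAut, baseAut_apply]

theorem shiftedAut_iterate_apply (A : (Fin k → ℤ) ≃+ (Fin k → ℤ)) (F : G ≃+ G)
    (z y : Fin k → ℤ) (f : (Fin k → ℤ) →₀ G) (n : ℕ) :
    (shiftedAut A F z)^[n] f y = F^[n] (f ((fun y => A.symm (-z + y))^[n] y)) := by
  induction n generalizing y with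
  | zero => rfl
  | succ n ih =>
    rw [Function.iterate_succ_apply', shiftedAut_apply, ih, ← Function.iterate_succ_apply' F,
      Function.iterate_succ_apply (fun y => A.symm (-z + y))]

theorem sum_iterate_map_sub {M : Type*} [AddCommGroup M] (T : M ≃+ M) (n : ℕ) (x : M) :
    T (∑ j ∈ Finset.range n, T^[j] x) - ∑ j ∈ Finset.range n, T^[j] x = T^[n] x - x := by
  rw [map_sum, ← Finset.sum_sub_distrib]
  simp_rw [← Function.iterate_succ_apply' T]
  exact Finset.sum_range_sub (fun j => T^[j] x) n

theorem iterate_eq_self_of_geomSum_eq_zero {M : Type*} [AddCommGroup M] {A : M ≃+ M} {m : ℕ}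
    (hA : ∀ x, ∑ j ∈ Finset.range m, A^[j] x = 0) (x : M) : A^[m] x = x := by
  have h := sum_iterate_map_sub A m x
  rw [hA, map_zero, sub_zero] at h
  exact (sub_eq_zero.mp h.symm)

theorem exists_map_sub_eq_nsmul {M : Type*} [AddCommGroup M] {A : M ≃+ M} {m : ℕ}
    (hA : ∀ x, ∑ j ∈ Finset.range m, A^[j] x = 0) (u : M) : ∃ v, A v - v = m • u := by
  -- A^n - 1 is A - 1 times the n-th partial geometric sum; adding over n < m gives 0 - m.
  refine ⟨-∑ n ∈ Finset.range m, ∑ j ∈ Finset.range n, A^[j] u, ?_⟩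
  rw [map_neg, map_sum, neg_sub_neg, ← neg_sub, ← Finset.sum_sub_distrib]
  simp_rw [sum_iterate_map_sub]
  simp [hA]

/-- The m-th iterate of x ↦ z + A x has linear part A^m = 1 and translation part the geometric sum
at z, which is 0. -/
theorem iterate_affine_inverse {M : Type*} [AddCommGroup M] {A : M ≃+ M} {m : ℕ}
    (hA : ∀ x, ∑ j ∈ Finset.range m, A^[j] x = 0) (z y : M) :
    (fun y => A.symm (-z + y))^[m] y = y := by
  have haff : ∀ n x, (fun x => z + A x)^[n] x = (∑ j ∈ Finset.range n, A^[j] z) + A^[n] x := by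
    intro n
    induction n with
    | zero => simp
    | succ n ih =>
      intro x
      rw [Function.iterate_succ_apply, ih, Finset.sum_range_succ, iterate_map_add,
        Function.iterate_succ_apply, add_assoc]
  have hinv : Function.LeftInverse (fun y => A.symm (-z + y)) (fun x => z + A x) :=
    fun x => by simp
  have h := hinv.iterate m y
  rwa [haff, hA, zero_add, iterate_eq_self_of_geomSum_eq_zero hA] at h

theorem shiftedAut_sub_self_surjective {A : (Fin k → ℤ) ≃+ (Fin k → ℤ)} {F : G ≃+ G} {m : ℕ}
    (hA : ∀ x, ∑ j ∈ Finset.range m, A^[j] x = 0)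
    (hF : Function.Surjective fun x => F^[m] x - x) (z : Fin k → ℤ) :
    Function.Surjective fun f => shiftedAut A F z f - f := by
  intro s
  obtain ⟨h, hh⟩ := Finsupp.mapRange_surjective (α := Fin k → ℤ) (fun x => F^[m] x - x)
    (by simp [iterate_map_zero]) hF s
  refine ⟨∑ j ∈ Finset.range m, (shiftedAut A F z)^[j] h, ?_⟩
  simp only [sum_iterate_map_sub]
  ext y
  rw [← hh, Finsupp.sub_apply, shiftedAut_iterate_apply, iterate_affine_inverse hA,
    Finsupp.mapRange_apply]

theorem reidemeisterNumber_wreathAut_lt_top {A : (Fin k → ℤ) ≃+ (Fin k → ℤ)} {F : G ≃+ G} {m : ℕ}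
    (hm : 0 < m) (hA : ∀ x, ∑ j ∈ Finset.range m, A^[j] x = 0)
    (hF : Function.Surjective fun x => F^[m] x - x) :
    reidemeisterNumber (wreathAut A F) < ⊤ := by
  let c : (Fin k → Fin m) → Quotient (reidemeisterSetoid (wreathAut A F)) := fun w =>
    Quotient.mk _ ⟨1, .ofAdd fun i => ((w i : ℕ) : ℤ)⟩
  have hc : Function.Surjective c := by
    intro q
    induction q using Quotient.inductionOn with
    | h x =>
    let w : Fin k → Fin m := fun i =>
      ⟨(x.right.toAdd i % m).toNat, by
        have := Int.emod_lt_of_pos (x.right.toAdd i) (Int.natCast_pos.mpr hm)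
        omega⟩
    let z : Fin k → ℤ := fun i => ((w i : ℕ) : ℤ)
    have hz : x.right.toAdd = z + m • fun i => x.right.toAdd i / m := by
      ext i
      have h0 := Int.emod_nonneg (x.right.toAdd i) (Int.natCast_pos.mpr hm).ne'
      have h1 := Int.emod_add_mul_ediv (x.right.toAdd i) m
      simp [z, w, h0, h1]
    refine ⟨w, Eq.symm (Quotient.sound ?_)⟩
    obtain ⟨v, hv⟩ := exists_map_sub_eq_nsmul hA fun i => x.right.toAdd i / m
    -- Only the ℤ^k-component is controlled here; the resulting Σ-component `s` is arbitrary and is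
    -- removed afterwards.
    have hmid : ∃ s, (reidemeisterSetoid (wreathAut A F)).r x ⟨.ofAdd s, .ofAdd z⟩ := by
      refine ⟨_, ⟨1, .ofAdd v⟩, SemidirectProduct.ext (Eq.refl _) ?_⟩
      apply Multiplicative.toAdd.injective
      change z = v + x.right.toAdd + A (-v)
      rw [hz, ← hv, map_neg]
      abel
    obtain ⟨s, hs⟩ := hmid
    refine (reidemeisterSetoid (wreathAut A F)).iseqv.trans hs ?_
    obtain ⟨t, ht⟩ := shiftedAut_sub_self_surjective hA hF z s
    refine ⟨⟨.ofAdd t, 1⟩, ?_⟩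
    have hti : (⟨.ofAdd t, 1⟩ : RestrictedWreath G k)⁻¹ = ⟨.ofAdd (-t), 1⟩ := by
      refine inv_eq_of_mul_eq_one_right (SemidirectProduct.ext ?_ ?_) <;> simp
    have hmap : wreathAut A F ⟨.ofAdd (-t), 1⟩ = ⟨.ofAdd (baseAut A F (-t)), 1⟩ :=
      SemidirectProduct.ext rfl (map_one (AddEquiv.toMultiplicative A))
    rw [hti, hmap]
    refine SemidirectProduct.ext ?_ (by simp [z])
    simp only [SemidirectProduct.mul_left, SemidirectProduct.mul_right, map_one, one_mul,
      MulAut.one_apply]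
    apply Multiplicative.toAdd.injective
    change (0 : (Fin k → ℤ) →₀ G) = t + s + shiftedAut A F z (-t)
    have ht' : s = shiftedAut A F z t - t := ht.symm
    rw [ht', map_neg]
    abel
  have := Finite.of_surjective c hc
  exact ENat.card_lt_top_of_finite

theorem exists_reidemeisterNumber_lt_top {m : ℕ} (hm : 0 < m)
    (hA : HasGeomSumZeroAut m (Fin k → ℤ)) (hF : HasPowSubOneSurjectiveAut m G) :
    ∃ φ : RestrictedWreath G k ≃* RestrictedWreath G k, reidemeisterNumber φ < ⊤ := by
  obtain ⟨A, hA⟩ := hA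
  obtain ⟨F, hF⟩ := hF
  exact ⟨wreathAut A F, reidemeisterNumber_wreathAut_lt_top hm hA hF⟩

end Wreath

universe u

/-! ### Direct sums, companion matrices, and the automorphisms of ℤ^k. -/

section Constructions

variable {m : ℕ} {M N R : Type*} [AddCommGroup M] [AddCommGroup N] [CommRing R]

theorem HasPowSubOneSurjectiveAut.of_addEquiv (e : M ≃+ N) (h : HasPowSubOneSurjectiveAut m M) :
    HasPowSubOneSurjectiveAut m N := by
  obtain ⟨F, hF⟩ := h
  refine ⟨e.symm.trans (F.trans e), fun y => ?_⟩
  obtain ⟨x, hx⟩ := hF (e.symm y)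
  have hs : Function.Semiconj e F (e.symm.trans (F.trans e)) := fun x => by simp
  refine ⟨e x, ?_⟩
  dsimp only at hx ⊢
  rw [← hs.iterate_right m, ← map_sub, hx, e.apply_symm_apply]

theorem HasPowSubOneSurjectiveAut.prod (hM : HasPowSubOneSurjectiveAut m M)
    (hN : HasPowSubOneSurjectiveAut m N) : HasPowSubOneSurjectiveAut m (M × N) := by
  obtain ⟨F, hF⟩ := hM
  obtain ⟨E, hE⟩ := hN
  refine ⟨F.prodCongr E, fun y => ?_⟩
  obtain ⟨a, ha⟩ := hF y.1
  obtain ⟨b, hb⟩ := hE y.2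
  refine ⟨(a, b), ?_⟩
  have h : ⇑(F.prodCongr E) = Prod.map F E := rfl
  simp only [h, Prod.map_iterate]
  exact Prod.ext ha hb

theorem HasPowSubOneSurjectiveAut.pi {ι : Type*} {M : ι → Type*} [∀ i, AddCommGroup (M i)]
    (h : ∀ i, HasPowSubOneSurjectiveAut m (M i)) : HasPowSubOneSurjectiveAut m (∀ i, M i) := by
  choose F hF using h
  refine ⟨AddEquiv.piCongrRight F, fun y => ?_⟩
  choose x hx using fun i => hF i (y i)
  refine ⟨x, ?_⟩
  have hit : ∀ n (x : ∀ i, M i) i, (AddEquiv.piCongrRight F)^[n] x i = (F i)^[n] (x i) := by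
    intro n
    induction n with
    | zero => simp
    | succ n ih => intro x i; rw [Function.iterate_succ_apply, ih]; rfl
  funext i
  simp only [Pi.sub_apply, hit]
  exact hx i

theorem HasPowSubOneSurjectiveAut.of_isUnit {u : R} (hu : IsUnit u) (h : IsUnit (u ^ m - 1)) :
    HasPowSubOneSurjectiveAut m R := by
  obtain ⟨u, rfl⟩ := hu
  refine ⟨AddEquiv.mk' (Units.mulLeft u) fun x y => mul_add _ _ _, fun y => ?_⟩
  obtain ⟨v, hv⟩ := h
  refine ⟨↑v⁻¹ * y, ?_⟩
  have hit : (⇑(AddEquiv.mk' (Units.mulLeft u) fun x y => mul_add _ _ _)) = ((u : R) * ·) := rfl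
  simp only [hit, mul_left_iterate]
  rw [← sub_one_mul, ← hv, Units.mul_inv_cancel_left]

theorem HasGeomSumZeroAut.of_addEquiv (e : M ≃+ N) (h : HasGeomSumZeroAut m M) :
    HasGeomSumZeroAut m N := by
  obtain ⟨A, hA⟩ := h
  refine ⟨e.symm.trans (A.trans e), fun y => ?_⟩
  have hs : Function.Semiconj e A (e.symm.trans (A.trans e)) := fun x => by simp
  obtain ⟨x, rfl⟩ := e.surjective y
  simp_rw [← (hs.iterate_right _).eq, ← map_sum, hA, map_zero]

theorem HasGeomSumZeroAut.prod (hM : HasGeomSumZeroAut m M) (hN : HasGeomSumZeroAut m N) :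
    HasGeomSumZeroAut m (M × N) := by
  obtain ⟨A, hA⟩ := hM
  obtain ⟨B, hB⟩ := hN
  refine ⟨A.prodCongr B, fun y => ?_⟩
  have h : ⇑(A.prodCongr B) = Prod.map A B := rfl
  simp only [h, Prod.map_iterate]
  exact Prod.ext (by simp [Prod.fst_sum, hA]) (by simp [Prod.snd_sum, hB])

theorem HasGeomSumZeroAut.mul_right (n : ℕ) (h : HasGeomSumZeroAut m M) :
    HasGeomSumZeroAut (m * n) M := by
  obtain ⟨A, hA⟩ := h
  refine ⟨A, fun x => ?_⟩
  induction n with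
  | zero => simp
  | succ n ih =>
    rw [mul_add_one, Finset.sum_range_add, ih, zero_add]
    simp_rw [add_comm (m * n), Function.iterate_add_apply, hA]

theorem HasGeomSumZeroAut.of_geomSum_eq_zero {u : R} (hm : 0 < m)
    (h : ∑ j ∈ Finset.range m, u ^ j = 0) : HasGeomSumZeroAut m R := by
  have hu : IsUnit u := by
    have h1 := mul_geom_sum u m
    rw [h, mul_zero] at h1
    exact IsUnit.of_pow_eq_one (sub_eq_zero.mp h1.symm) hm.ne'
  obtain ⟨u, rfl⟩ := hu
  refine ⟨AddEquiv.mk' (Units.mulLeft u) fun x y => mul_add _ _ _, fun y => ?_⟩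
  have hit : (⇑(AddEquiv.mk' (Units.mulLeft u) fun x y => mul_add _ _ _)) = ((u : R) * ·) := rfl
  simp_rw [hit, mul_left_iterate, ← Finset.sum_mul, h, zero_mul]

/-- Concatenation of tuples, as an additive equivalence. -/
def finAppendAddEquiv (M : Type*) [AddCommGroup M] (a b : ℕ) :
    (Fin a → M) × (Fin b → M) ≃+ (Fin (a + b) → M) :=
  ((LinearEquiv.funCongrLeft ℤ M finSumFinEquiv).trans
    (LinearEquiv.sumArrowLequivProdArrow (Fin a) (Fin b) ℤ M)).symm.toAddEquiv

theorem HasPowSubOneSurjectiveAut.fin_add {a b : ℕ} (ha : HasPowSubOneSurjectiveAut m (Fin a → M))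
    (hb : HasPowSubOneSurjectiveAut m (Fin b → M)) :
    HasPowSubOneSurjectiveAut m (Fin (a + b) → M) :=
  (ha.prod hb).of_addEquiv (finAppendAddEquiv M a b)

theorem HasGeomSumZeroAut.fin_add {a b : ℕ} (ha : HasGeomSumZeroAut m (Fin a → M))
    (hb : HasGeomSumZeroAut m (Fin b → M)) : HasGeomSumZeroAut m (Fin (a + b) → M) :=
  (ha.prod hb).of_addEquiv (finAppendAddEquiv M a b)

theorem HasPowSubOneSurjectiveAut.fin_mul {a : ℕ} (ha : HasPowSubOneSurjectiveAut m (Fin a → M))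
    (n : ℕ) : HasPowSubOneSurjectiveAut m (Fin (a * n) → M) := by
  induction n with
  | zero => exact ⟨AddEquiv.refl _, fun y => ⟨y, funext fun i => i.elim0⟩⟩
  | succ n ih => exact ih.fin_add ha

theorem HasGeomSumZeroAut.fin_mul {a : ℕ} (ha : HasGeomSumZeroAut m (Fin a → M))
    (n : ℕ) : HasGeomSumZeroAut m (Fin (a * n) → M) := by
  induction n with
  | zero => exact ⟨AddEquiv.refl _, fun y => funext fun i => i.elim0⟩
  | succ n ih => exact ih.fin_add ha

/-- The additive group of `R[X] ⧸ (f)`, for `f` monic of degree `d`. -/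
noncomputable def adjoinRootAddEquiv {f : R[X]} (hf : f.Monic) {d : ℕ} (hd : f.natDegree = d) :
    AdjoinRoot f ≃+ (Fin d → R) :=
  ((AdjoinRoot.powerBasis' hf).basis.equivFun.trans
    (LinearEquiv.funCongrLeft R R (finCongr hd.symm))).toAddEquiv

theorem AdjoinRoot.aeval_root_self (f : R[X]) : aeval (AdjoinRoot.root f) f = 0 := by
  rw [AdjoinRoot.aeval_eq, AdjoinRoot.mk_self]

/-- If every root `u` of `X ^ d - X ^ i - 1` in an `R`-algebra is a unit with `u ^ m - 1` a unit, then
the companion matrix of this trinomial provides the required automorphism. -/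
theorem HasPowSubOneSurjectiveAut.of_trinomial {R : Type u} [CommRing R] {i d : ℕ} (hi : 0 < i)
    (hid : i < d)
    (h : ∀ (S : Type u) [CommRing S] [Algebra R S] (u : S),
      u ^ d = u ^ i + 1 → IsUnit u ∧ IsUnit (u ^ m - 1)) :
    HasPowSubOneSurjectiveAut m (Fin d → R) := by
  -- Over the zero ring the trinomial does not have degree `d`.
  cases subsingleton_or_nontrivial R
  · exact ⟨AddEquiv.refl _, fun y => ⟨y, Subsingleton.elim _ _⟩⟩
  let f : R[X] := trinomial 0 i d (-1) (-1) 1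
  have hf : f.Monic := trinomial_monic hi hid
  have hd : f.natDegree = d := trinomial_natDegree hi hid one_ne_zero
  obtain ⟨hu, hum⟩ := h (AdjoinRoot f) (AdjoinRoot.root f) (by
    have hroot : aeval (AdjoinRoot.root f) (trinomial 0 i d (-1) (-1) 1 : R[X]) = 0 :=
      AdjoinRoot.aeval_root_self f
    rw [trinomial_def] at hroot
    simp only [map_neg, map_one, map_add, map_mul, map_pow, aeval_X] at hroot
    linear_combination hroot)
  exact (of_isUnit hu hum).of_addEquiv (adjoinRootAddEquiv hf hd)

theorem HasGeomSumZeroAut.fin_int (p : ℕ) [hp : Fact p.Prime] :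
    HasGeomSumZeroAut p (Fin (p - 1) → ℤ) := by
  have hd : (cyclotomic p ℤ).natDegree = p - 1 := by
    rw [natDegree_cyclotomic, Nat.totient_prime hp.out]
  refine (of_geomSum_eq_zero (u := AdjoinRoot.root (cyclotomic p ℤ)) hp.out.pos ?_).of_addEquiv
    (adjoinRootAddEquiv (cyclotomic.monic p ℤ) hd)
  have h : aeval (AdjoinRoot.root (cyclotomic p ℤ)) (∑ j ∈ Finset.range p, (X : ℤ[X]) ^ j) = 0 := by
    rw [← cyclotomic_prime, AdjoinRoot.aeval_root_self]
  simpa using h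

theorem hasGeomSumZeroAut_two (k : ℕ) : HasGeomSumZeroAut 2 (Fin k → ℤ) := by
  rw [← one_mul k]
  exact (HasGeomSumZeroAut.fin_int 2).fin_mul k

theorem hasGeomSumZeroAut_three {k : ℕ} (hk : Even k) : HasGeomSumZeroAut 3 (Fin k → ℤ) := by
  obtain ⟨n, rfl⟩ := hk.two_dvd
  exact (HasGeomSumZeroAut.fin_int 3).fin_mul n

theorem hasGeomSumZeroAut_five {k : ℕ} (hk : 4 ∣ k) : HasGeomSumZeroAut 5 (Fin k → ℤ) := by
  obtain ⟨n, rfl⟩ := hk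
  have : Fact (Nat.Prime 5) := ⟨by norm_num⟩
  exact (HasGeomSumZeroAut.fin_int 5).fin_mul n

theorem hasGeomSumZeroAut_thirtyFive {k : ℕ} (hk : Even k) (hk4 : 4 ≤ k) :
    HasGeomSumZeroAut 35 (Fin k → ℤ) := by
  have : Fact (Nat.Prime 7) := ⟨by norm_num⟩
  have h5 : ∀ {n : ℕ}, 4 ∣ n → HasGeomSumZeroAut 35 (Fin n → ℤ) := fun hn =>
    (hasGeomSumZeroAut_five hn).mul_right 7
  -- If k ≡ 2 mod 4, one block of rank 6 from Φ_7 leaves a multiple of 4 for Φ_5; 35 serves both.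
  obtain hk' | ⟨n, hn, rfl⟩ : 4 ∣ k ∨ ∃ n, 4 ∣ n ∧ k = n + 6 := by
    obtain ⟨j, rfl⟩ := hk
    by_cases h : 4 ∣ j + j
    · exact Or.inl h
    · exact Or.inr ⟨j + j - 6, by omega, by omega⟩
  · exact h5 hk'
  · exact (h5 hn).fin_add ((HasGeomSumZeroAut.fin_int 7).mul_right 5)

end Constructions

/-! ### Automorphisms of free modules over the coefficient rings. -/

section Coefficients

variable {R : Type u} [CommRing R]

theorem hasPowSubOneSurjectiveAut_of_le {m : ℕ} (hm : 2 ≤ m) {d : ℕ} (hd : m ≤ d) :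
    HasPowSubOneSurjectiveAut m (Fin d → R) := by
  obtain rfl | hlt := hd.eq_or_lt
  -- For d = m take X^m - X - 1, so that u^m - 1 = u; for d > m take X^d - X^(d-m) - 1, so that (u^m
  -- - 1) u^(d-m) = 1.
  · refine HasPowSubOneSurjectiveAut.of_trinomial one_pos hm fun S _ _ u hu => ?_
    obtain ⟨n, rfl⟩ := Nat.exists_eq_add_of_le hm
    have h : (u ^ (1 + n) - 1) * u = 1 := by linear_combination hu
    have huu : IsUnit u := .of_mul_eq_one_right _ h
    exact ⟨huu, by rwa [hu, pow_one, add_sub_cancel_right]⟩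
  · obtain ⟨n, rfl⟩ := Nat.exists_eq_add_of_lt hlt
    refine HasPowSubOneSurjectiveAut.of_trinomial (i := n + 1) n.succ_pos (by omega)
      fun S _ _ u hu => ?_
    have h : (u ^ m - 1) * u ^ (n + 1) = 1 := by linear_combination hu
    exact ⟨(isUnit_pow_iff n.succ_ne_zero).mp (.of_mul_eq_one_right _ h), .of_mul_eq_one _ h⟩

theorem hasPowSubOneSurjectiveAut_of_odd {m : ℕ} (hm : Odd m) (h2 : IsUnit (2 : R)) (d : ℕ) :
    HasPowSubOneSurjectiveAut m (Fin d → R) := by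
  refine .pi fun _ => .of_isUnit (u := (-1 : R)) isUnit_one.neg ?_
  rw [hm.neg_one_pow]
  convert h2.neg using 1
  ring

theorem hasPowSubOneSurjectiveAut_two_of_isUnit (h2 : IsUnit (2 : R)) (h3 : IsUnit (3 : R))
    (d : ℕ) : HasPowSubOneSurjectiveAut 2 (Fin d → R) := by
  refine .pi fun _ => .of_isUnit h2 ?_
  convert h3 using 1
  norm_num

theorem IsNilpotent.isUnit_add_two_mul {S : Type*} [CommRing S] (h2 : IsNilpotent (2 : S)) {u : S}
    (hu : IsUnit u) (v : S) : IsUnit (u + 2 * v) :=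
  IsNilpotent.isUnit_add_left_of_commute ((Commute.all _ _).isNilpotent_mul_right h2) hu
    (Commute.all _ _)

theorem isNilpotent_two_of_algebra {S : Type*} [CommRing S] [Algebra R S]
    (h2 : IsNilpotent (2 : R)) : IsNilpotent (2 : S) := by
  simpa only [map_ofNat] using h2.map (algebraMap R S)

/-- Modulo 2, u² = u + 1 forces u³ = 1, so u^5 - 1 ≡ u² - 1 ≡ u is a unit up to a nilpotent. -/
theorem hasPowSubOneSurjectiveAut_five_fin_two (h2 : IsNilpotent (2 : R)) :
    HasPowSubOneSurjectiveAut 5 (Fin 2 → R) := by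
  refine .of_trinomial one_pos one_lt_two fun S _ _ u hu => ?_
  have hu' : IsUnit u := .of_mul_eq_one (u - 1) (by linear_combination hu)
  refine ⟨hu', ?_⟩
  convert (isNilpotent_two_of_algebra h2).isUnit_add_two_mul hu' (2 * u + 1) using 1
  linear_combination (u ^ 3 + u ^ 2 + 2 * u + 3) * hu

theorem hasPowSubOneSurjectiveAut_thirtyFive_fin_two (h2 : IsNilpotent (2 : R)) :
    HasPowSubOneSurjectiveAut 35 (Fin 2 → R) := by
  refine .of_trinomial one_pos one_lt_two fun S _ _ u hu => ?_
  have hu' : IsUnit u := .of_mul_eq_one (u - 1) (by linear_combination hu)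
  refine ⟨hu', ?_⟩
  -- The coefficients are Fibonacci numbers: u^n = F_n u + F_(n-1). As 35 ≡ 2 mod 3, again u^35 - 1
  -- ≡ u mod 2.
  have h5 : u ^ 5 = 5 * u + 3 := by linear_combination (u ^ 3 + u ^ 2 + 2 * u + 3) * hu
  have h10 : u ^ 10 = 55 * u + 34 := by
    linear_combination (u ^ 5 + 5 * u + 3) * h5 + 25 * hu
  have h20 : u ^ 20 = 6765 * u + 4181 := by
    linear_combination (u ^ 10 + 55 * u + 34) * h10 + 3025 * hu
  have h30 : u ^ 30 = 832040 * u + 514229 := by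
    linear_combination u ^ 10 * h20 + (6765 * u + 4181) * h10 + 372075 * hu
  have h35 : u ^ 35 = 9227465 * u + 5702887 := by
    linear_combination u ^ 5 * h30 + (832040 * u + 514229) * h5 + 4160200 * hu
  convert (isNilpotent_two_of_algebra h2).isUnit_add_two_mul hu' (4613732 * u + 2851443) using 1
  rw [h35]
  ring

theorem hasPowSubOneSurjectiveAut_five_fin_three : HasPowSubOneSurjectiveAut 5 (Fin 3 → R) := by
  refine .of_trinomial one_pos (by norm_num) fun S _ _ u hu => ?_
  refine ⟨.of_mul_eq_one (u ^ 2 - 1) (by linear_combination hu),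
    .of_mul_eq_one (u - 1) ?_⟩
  linear_combination (u ^ 3 - u ^ 2 + u) * hu

/-- Modulo 2, a root of X^5 - X² - 1 satisfies u^31 = 1, so u^35 - 1 ≡ u^4 - 1 ≡ (u - 1)^4. Rank 3
fails to be covered by X³ - X - 1, whose roots mod 2 satisfy u^7 = 1 with 7 ∣ 35. -/
theorem hasPowSubOneSurjectiveAut_thirtyFive_fin_five (h2 : IsNilpotent (2 : R)) :
    HasPowSubOneSurjectiveAut 35 (Fin 5 → R) := by
  refine .of_trinomial two_pos (by norm_num) fun S _ _ u hu => ?_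
  have hu1 : IsUnit (u - 1) :=
    .of_mul_eq_one (u ^ 2 * (u ^ 2 + u + 1)) (by linear_combination hu)
  refine ⟨.of_mul_eq_one (u ^ 4 - u) (by linear_combination hu), ?_⟩
  have h10 : u ^ 10 = u ^ 4 + 2 * u ^ 2 + 1 := by
    linear_combination (u ^ 5 + u ^ 2 + 1) * hu
  have h20 : u ^ 20 = 6 * u ^ 4 + 5 * u ^ 3 + 5 * u ^ 2 + 4 * u + 2 := by
    linear_combination (u ^ 10 + u ^ 4 + 2 * u ^ 2 + 1) * h10 + (u ^ 3 + 4 * u + 1) * hu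
  have h30 : u ^ 30 = 23 * u ^ 4 + 36 * u ^ 3 + 34 * u ^ 2 + 21 * u + 22 := by
    linear_combination u ^ 10 * h20 + (6 * u ^ 4 + 5 * u ^ 3 + 5 * u ^ 2 + 4 * u + 2) * h10 +
      (6 * u ^ 3 + 5 * u ^ 2 + 17 * u + 20) * hu
  have h35 : u ^ 35 = 57 * u ^ 4 + 80 * u ^ 3 + 92 * u ^ 2 + 44 * u + 58 := by
    linear_combination u ^ 5 * h30 + (23 * u ^ 4 + 36 * u ^ 3 + 34 * u ^ 2 + 21 * u + 22) * hu +
      (23 * u + 36) * hu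
  convert (isNilpotent_two_of_algebra h2).isUnit_add_two_mul (hu1.pow 4)
    (28 * u ^ 4 + 42 * u ^ 3 + 43 * u ^ 2 + 24 * u + 28) using 1
  rw [h35]
  ring

theorem hasPowSubOneSurjectiveAut_five (h2 : IsNilpotent (2 : R)) {d : ℕ} (hd : 2 ≤ d) :
    HasPowSubOneSurjectiveAut 5 (Fin d → R) := by
  have heven := fun n => (hasPowSubOneSurjectiveAut_five_fin_two h2).fin_mul n
  obtain h | h := d.even_or_odd
  · obtain ⟨n, rfl⟩ := h.two_dvd
    exact heven n
  · obtain ⟨n, rfl⟩ : ∃ n, d = 2 * n + 3 := ⟨(d - 3) / 2, by grind⟩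
    exact (heven n).fin_add hasPowSubOneSurjectiveAut_five_fin_three

theorem hasPowSubOneSurjectiveAut_thirtyFive (h2 : IsNilpotent (2 : R)) {d : ℕ} (hd : 2 ≤ d)
    (hd3 : d ≠ 3) : HasPowSubOneSurjectiveAut 35 (Fin d → R) := by
  have heven := fun n => (hasPowSubOneSurjectiveAut_thirtyFive_fin_two h2).fin_mul n
  obtain h | h := d.even_or_odd
  · obtain ⟨n, rfl⟩ := h.two_dvd
    exact heven n
  · obtain ⟨n, rfl⟩ : ∃ n, d = 2 * n + 5 := ⟨(d - 5) / 2, by grind⟩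
    exact (heven n).fin_add (hasPowSubOneSurjectiveAut_thirtyFive_fin_five h2)

end Coefficients

/-! ### Choice of m in each case, and the theorem. -/

theorem ZMod.isUnit_natCast_prime_pow {p q : ℕ} (hp : p.Prime) (hq : q.Prime) (hpq : p ≠ q)
    (r : ℕ) : IsUnit (q : ZMod (p ^ r)) :=
  (ZMod.isUnit_iff_coprime _ _).mpr (((Nat.coprime_primes hq hp).mpr hpq.symm).pow_right r)

theorem ZMod.isNilpotent_two (r : ℕ) : IsNilpotent (2 : ZMod (2 ^ r)) :=
  ⟨r, by exact_mod_cast ZMod.natCast_self (2 ^ r)⟩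

theorem exists_hasGeomSumZeroAut_and_hasPowSubOneSurjectiveAut {k : ℕ} {ι : Type*}
    {p r d : ι → ℕ} (hp : ∀ i, (p i).Prime)
    (hcases :
      (∀ i, p i = 2 ∨ p i = 3 → 2 ≤ d i) ∨
      ((∀ i, p i ≠ 2) ∧ Even k) ∨
      ((∀ i, p i = 2 → 2 ≤ d i) ∧ 4 ∣ k) ∨
      ((∀ i, p i = 2 → 3 ≤ d i) ∧ Even k) ∨
      ((∀ i, p i = 2 → 2 ≤ d i ∧ d i ≠ 3) ∧ Even k ∧ 4 ≤ k)) :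
    ∃ m, 0 < m ∧ HasGeomSumZeroAut m (Fin k → ℤ) ∧
      HasPowSubOneSurjectiveAut m ((i : ι) → Fin (d i) → ZMod (p i ^ r i)) := by
  have hunit2 : ∀ i, p i ≠ 2 → IsUnit (2 : ZMod (p i ^ r i)) := fun i h => by
    exact_mod_cast ZMod.isUnit_natCast_prime_pow (hp i) Nat.prime_two h (r i)
  have hunit3 : ∀ i, p i ≠ 3 → IsUnit (3 : ZMod (p i ^ r i)) := fun i h => by
    exact_mod_cast ZMod.isUnit_natCast_prime_pow (hp i) Nat.prime_three h (r i)
  have hnil : ∀ i, p i = 2 → IsNilpotent (2 : ZMod (p i ^ r i)) := fun i h => by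
    rw [h]
    exact ZMod.isNilpotent_two _
  have hodd : ∀ {m : ℕ}, Odd m →
      (∀ i, p i = 2 → HasPowSubOneSurjectiveAut m (Fin (d i) → ZMod (p i ^ r i))) →
      HasPowSubOneSurjectiveAut m ((i : ι) → Fin (d i) → ZMod (p i ^ r i)) := fun hm h =>
    .pi fun i => (em (p i = 2)).elim (h i) fun hi =>
      hasPowSubOneSurjectiveAut_of_odd hm (hunit2 i hi) (d i)
  obtain h | ⟨h, hk⟩ | ⟨h, hk⟩ | ⟨h, hk⟩ | ⟨h, hk, hk4⟩ := hcases
  · refine ⟨2, two_pos, hasGeomSumZeroAut_two k, .pi fun i => ?_⟩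
    by_cases hi : p i = 2 ∨ p i = 3
    · exact hasPowSubOneSurjectiveAut_of_le le_rfl (h i hi)
    · rw [not_or] at hi
      exact hasPowSubOneSurjectiveAut_two_of_isUnit (hunit2 i hi.1) (hunit3 i hi.2) (d i)
  · exact ⟨3, three_pos, hasGeomSumZeroAut_three hk, hodd (by decide) fun i hi => absurd hi (h i)⟩
  · exact ⟨5, by norm_num, hasGeomSumZeroAut_five hk, hodd (by decide) fun i hi =>
      hasPowSubOneSurjectiveAut_five (hnil i hi) (h i hi)⟩
  · exact ⟨3, three_pos, hasGeomSumZeroAut_three hk, hodd (by decide) fun i hi =>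
      hasPowSubOneSurjectiveAut_of_le (by norm_num) (h i hi)⟩
  · exact ⟨35, by norm_num, hasGeomSumZeroAut_thirtyFive hk hk4, hodd (by decide) fun i hi =>
      hasPowSubOneSurjectiveAut_thirtyFive (hnil i hi) (h i hi).1 (h i hi).2⟩

theorem theorem1 {G : Type*} [AddCommGroup G] [Finite G] (k : ℕ)
    {ι : Type*} [Finite ι] (p r d : ι → ℕ)
    (hp : ∀ i, (p i).Prime) (hr : ∀ i, 1 ≤ r i) (hd : ∀ i, 1 ≤ d i)
    (hpr : Function.Injective fun i => (p i, r i))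
    (e : G ≃+ ((i : ι) → Fin (d i) → ZMod (p i ^ r i)))
    (hcases :
      (∀ i, p i = 2 ∨ p i = 3 → 2 ≤ d i) ∨
      ((∀ i, p i ≠ 2) ∧ Even k) ∨
      ((∀ i, p i = 2 → 2 ≤ d i) ∧ 4 ∣ k) ∨
      ((∀ i, p i = 2 → 3 ≤ d i) ∧ Even k) ∨
      ((∀ i, p i = 2 → 2 ≤ d i ∧ d i ≠ 3) ∧ Even k ∧ 4 ≤ k)) :
    (∃ φ : RestrictedWreath G k ≃* RestrictedWreath G k, reidemeisterNumber φ < ⊤) ∧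
      ¬ HasRInfinity (RestrictedWreath G k) := by
  obtain ⟨m, hm, hA, hF⟩ := exists_hasGeomSumZeroAut_and_hasPowSubOneSurjectiveAut hp hcases
  obtain ⟨φ, hφ⟩ := exists_reidemeisterNumber_lt_top hm hA (hF.of_addEquiv e.symm)
  exact ⟨⟨φ, hφ⟩, fun h => hφ.ne (h φ)⟩
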